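/- Let $n\ge 2$ and $\varepsilon\in\{\pm1\}$. Let $V$ be a finite-dimensional complex vector space of dimension $v$ with an $\varepsilon$-form, i.e. a nondegenerate bilinear form with $(u,u')=\varepsilon(u',u)$. Let $\mathcal N_{n,v,\varepsilon}$ be the set of nilpotent $x$ in the Lie algebra of the isometry group of $V$ with $x^n=0$. Let $\mathcal F_{n,v,\varepsilon}$ be the variety of flags $0=F_0\subseteq F_1\subseteq\dots\subseteq F_n=V$ with $F_i^\perp=F_{n-i}$ for all $i$. Let $\mathcal M_{n,v,\varepsilon}$ be its cotangent bundle, i.e. the set of pairs $(x,F)\in\mathcal N_{n,v,\varepsilon}\times\mathcal F_{n,v,\varepsilon}$ with $x(F_i)\subseteq F_{i-1}$ for $1\le i\le n$, and let $\pi(x,F)=x$. On $\mathbb C^{2n}$ fix a basis $a_1,\dots,a_n,b_1,\dots,b_n$ and the $\varepsilon$-form with $(a_i,b_j)=\delta_{ij}$, $(a_i,a_j)=(b_i,b_j)=0$. Let $e_\varepsilon$ be given by $a_i\mapsto a_{i-1}$, $b_i\mapsto -b_{i+1}$ (with $a_0=b_{n+1}=0$), and let $\mathbf F_\varepsilon$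 be the flag whose $i$-th step is $\langle a_1,\dots,a_i,b_n,\dots,b_{n+1-i}\rangle$. Equip $V\oplus\mathbb C^{2n}$ with the direct sum form, and put $i_\varepsilon(x)=x\oplus e_\varepsilon$ and $i_{\mathcal M}(x,F)=(x\oplus e_\varepsilon,F\oplus\mathbf F_\varepsilon)$, where the flags are added step by step. (1) The direct sum form on $V\oplus\mathbb C^{2n}$ is an $\varepsilon$-form, and $i_\varepsilon:\mathcal N_{n,v,\varepsilon}\to\mathcal N_{n,v+2n,\varepsilon}$, $i_{\mathcal M}:\mathcal M_{n,v,\varepsilon}\to\mathcal M_{n,v+2n,\varepsilon}$ are well defined with $\pi\circ i_{\mathcal M}=i_\varepsilon\circ\pi$. This square is cartesian: for all $x\in\mathcal N_{n,v,\varepsilon}$, $$i_{\mathcal M}(\pi^{-1}(x))=\pi^{-1}(x\oplus e_\varepsilon);$$ each $m'\in\mathcal M_{n,v+2n,\varepsilon}$ with $\pi(m')=i_\varepsilon(x)$ comes from exactly one $m\in\mathcal M_{n,v,\varepsilon}$ with $i_{\mathcal M}(m)=m'$ and $\pi(m)=x$; and $i_{\mathcal M}$ is an isomorphism of varieties from $\mathcal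 M_{n,v,\varepsilon}$ onto $\pi^{-1}(i_\varepsilon(\mathcal N_{n,v,\varepsilon}))\subseteq\mathcal M_{n,v+2n,\varepsilon}$. (2) Spaltenstein varieties are unchanged under the row reduction that removes two rows of length $n$: let $x\in\mathcal N_{n,v,\varepsilon}$. The Jordan type of $x\oplus e_\varepsilon$ is that of $x$ with two parts $n$ added, that is, $\dim\ker (x\oplus e_\varepsilon)^k=\dim\ker x^k+2\min(k,n)$ for all $k\ge0$. The map $i_{\mathcal M}$ restricts to an isomorphism of varieties $\pi^{-1}(x)\to\pi^{-1}(x\oplus e_\varepsilon)$. For every $d=(d_1,\dots,d_n)\in\mathbb N^n$ it restricts to an isomorphism from the Spaltenstein variety $\{(x,F)\in\pi^{-1}(x):\dim F_i/F_{i-1}=d_i\ \forall i\}$ onto the Spaltenstein variety of $x\oplus e_\varepsilon$ of type $(d_1+2,\dots,d_n+2)$. Consequently the former is also isomorphic, as a variety, to the Spaltenstein variety of type $(d_1+2,\dots,d_n+2)$ of any $x'\in\mathrm{End}(V')$, where $V'$ is a space with a bilinear form and $x'$ is the conjugate of $x\oplus e_\varepsilon$ under some linear isometry $V\oplus\mathbb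 C^{2n}\cong V'$. -/

import Mathlib

noncomputable section

namespace Nilcone

/-! ### Complex algebraic sets of pairs (endomorphism, flag of subspaces)

Points are pairs `(x, F)` of an endomorphism `x` of `V` and a sequence `F 0, …, F n` of subspaces
of `V`.  The algebraic structure is that of `End V` times a product of (disjoint unions of)
Grassmannians, a Grassmannian of `k`-planes being the quotient of the variety of linearly
independent `k`-tuples of vectors by `GL k`: a set is Zariski open, and a function is regular, if
it is so after pulling back to pairs `(x, A)` where `A i` is a basis of `F i`. -/

/-- The ring of polynomial functions on a complex vector space. -/
def polyFun (E : Type*) [AddCommGroup E] [Module ℂ E] : Subalgebra ℂ (E → ℂ) :=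
  Algebra.adjoin ℂ (Set.range fun (l : Module.Dual ℂ E) (e : E) => l e)

/-- Pairs of an endomorphism and a sequence of `n + 1` subspaces. -/
abbrev Pt (n : ℕ) (V : Type*) [AddCommGroup V] [Module ℂ V] : Type _ :=
  Module.End ℂ V × (Fin (n + 1) → Submodule ℂ V)

/-- Pairs of an endomorphism and a sequence of tuples of vectors of lengths `D 0, …, D n`. -/
abbrev PreFrame {n : ℕ} (V : Type*) [AddCommGroup V] [Module ℂ V] (D : Fin (n + 1) → ℕ) : Type _ :=
  Module.End ℂ V × ((i : Fin (n + 1)) → Fin (D i) → V)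

section Varieties

variable {n : ℕ} {V : Type*} [AddCommGroup V] [Module ℂ V]
variable {V' : Type*} [AddCommGroup V'] [Module ℂ V']

/-- All the tuples are linearly independent. -/
def IsFrame {D : Fin (n + 1) → ℕ} (a : PreFrame V D) : Prop :=
  ∀ i, LinearIndependent ℂ (a.2 i)

/-- The pair (endomorphism, spans of the tuples). -/
def toPt {D : Fin (n + 1) → ℕ} (a : PreFrame V D) : Pt n V :=
  (a.1, fun i => Submodule.span ℂ (Set.range (a.2 i)))

/-- `U` is a Zariski open subset of `Z`. -/
def IsZariskiOpenIn (Z U : Set (Pt n V)) : Prop :=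
  U ⊆ Z ∧ ∀ (D : Fin (n + 1) → ℕ) (a : PreFrame V D), IsFrame a → toPt a ∈ U →
    ∃ q ∈ polyFun (PreFrame V D), q a ≠ 0 ∧
      ∀ b : PreFrame V D, IsFrame b → toPt b ∈ Z → q b ≠ 0 → toPt b ∈ U

/-- `f` is a regular function on `U`: locally a quotient of polynomials. -/
def IsRegularOn (U : Set (Pt n V)) (f : Pt n V → ℂ) : Prop :=
  ∀ (D : Fin (n + 1) → ℕ) (a : PreFrame V D), IsFrame a → toPt a ∈ U →
    ∃ p ∈ polyFun (PreFrame V D), ∃ q ∈ polyFun (PreFrame V D), q a ≠ 0 ∧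
      ∀ b : PreFrame V D, IsFrame b → toPt b ∈ U → q b ≠ 0 → f (toPt b) = p b / q b

/-- `φ` is a morphism of varieties from `Z` to `Z'`: it is continuous for the Zariski topologies
and pulls regular functions on open sets back to regular functions. -/
def IsVarietyMorphism (φ : Pt n V → Pt n V') (Z : Set (Pt n V)) (Z' : Set (Pt n V')) : Prop :=
  Set.MapsTo φ Z Z' ∧
  ∀ U' : Set (Pt n V'), IsZariskiOpenIn Z' U' →
    IsZariskiOpenIn Z (Z ∩ φ ⁻¹' U') ∧
    ∀ f : Pt n V' → ℂ, IsRegularOn U' f → IsRegularOn (Z ∩ φ ⁻¹' U') (f ∘ φ)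

/-- `φ` restricts to an isomorphism of varieties from `Z` onto `Z'`. -/
def IsVarietyIso (φ : Pt n V → Pt n V') (Z : Set (Pt n V)) (Z' : Set (Pt n V')) : Prop :=
  IsVarietyMorphism φ Z Z' ∧
  ∃ ψ : Pt n V' → Pt n V, IsVarietyMorphism ψ Z' Z ∧ Set.InvOn ψ φ Z Z'

end Varieties

/-! ### Nilcones, isotropic flags and Spaltenstein varieties -/

section Classical

variable {V : Type*} [AddCommGroup V] [Module ℂ V]

/-- A nondegenerate bilinear form with `(u, w) = ε (w, u)`, where `ε = ±1`. -/
def IsEpsForm (ε : ℤˣ) (B : LinearMap.BilinForm ℂ V) : Prop :=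
  B.Nondegenerate ∧ ∀ u w : V, B u w = ((ε : ℤ) : ℂ) * B w u

/-- The `n`-nilcone: nilpotent elements `x` of the Lie algebra of the isometry group of `B`
with `x ^ n = 0`. -/
def nilcone (B : LinearMap.BilinForm ℂ V) (n : ℕ) : Set (Module.End ℂ V) :=
  {x | x ∈ skewAdjointLieSubalgebra B ∧ IsNilpotent x ∧ x ^ n = 0}

/-- Isotropic `n`-step flags. -/
def isotropicFlags (B : LinearMap.BilinForm ℂ V) (n : ℕ) :
    Set (Fin (n + 1) → Submodule ℂ V) :=
  {F | F 0 = ⊥ ∧ F (Fin.last n) = ⊤ ∧ Monotone F ∧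
    ∀ i : Fin (n + 1), B.orthogonal (F i) = F i.rev}

/-- The cotangent bundle of the variety of isotropic `n`-step flags, as a set of pairs. -/
def cotangentFlags (B : LinearMap.BilinForm ℂ V) (n : ℕ) : Set (Pt n V) :=
  {m | m.1 ∈ nilcone B n ∧ m.2 ∈ isotropicFlags B n ∧
    ∀ i : Fin n, (m.2 i.succ).map m.1 ≤ m.2 i.castSucc}

/-- The projection to the nilcone. -/
def proj {n : ℕ} (m : Pt n V) : Module.End ℂ V := m.1

/-- The fibre of the projection from the cotangent bundle to the nilcone. -/
def fiber (B : LinearMap.BilinForm ℂ V) (n : ℕ) (x : Module.End ℂ V) : Set (Pt n V) :=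
  {m | m ∈ cotangentFlags B n ∧ proj m = x}

/-- The flags whose successive quotients have dimensions `d 0, …, d (n - 1)`. -/
def HasDims {n : ℕ} (F : Fin (n + 1) → Submodule ℂ V) (d : Fin n → ℕ) : Prop :=
  ∀ i : Fin n, Module.finrank ℂ (F i.succ) = Module.finrank ℂ (F i.castSucc) + d i

/-- The Spaltenstein variety of `x` and of the isotropic flags of type `d`. -/
def spaltenstein (B : LinearMap.BilinForm ℂ V) {n : ℕ} (d : Fin n → ℕ) (x : Module.End ℂ V) :
    Set (Pt n V) :=
  {m | m ∈ fiber B n x ∧ HasDims m.2 d}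

end Classical

/-! ### The space `ℂ^{2n}` with its form, nilpotent element and flag -/

/-- `ℂ^{2n}`, with coordinates in two blocks of length `n`. -/
abbrev Std (n : ℕ) : Type := Fin n ⊕ Fin n → ℂ

/-- The nilpotent Jordan block. -/
def jordanBlock (n : ℕ) : Matrix (Fin n) (Fin n) ℂ :=
  Matrix.of fun i j => if (i : ℕ) + 1 = j then 1 else 0

/-- The antidiagonal matrix. -/
def antiDiag (n : ℕ) : Matrix (Fin n) (Fin n) ℂ :=
  Matrix.of fun i j => if j = i.rev then 1 else 0

/-- The bilinear form on `ℂ^{2n}` with matrix `[[0, J], [ε J, 0]]`. -/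
def stdForm (ε : ℤˣ) (n : ℕ) : LinearMap.BilinForm ℂ (Std n) :=
  Matrix.toBilin' (Matrix.fromBlocks 0 (antiDiag n) (((ε : ℤ) : ℂ) • antiDiag n) 0)

/-- The nilpotent endomorphism of `ℂ^{2n}` with matrix `[[e, 0], [0, -e]]`. -/
def stdNilp (n : ℕ) : Module.End ℂ (Std n) :=
  Matrix.toLin' (Matrix.fromBlocks (jordanBlock n) 0 0 (-jordanBlock n))

/-- The vectors `a_1, …, a_n` (indexed from `0`). -/
def aVec {n : ℕ} (i : Fin n) : Std n := Pi.single (Sum.inl i) 1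

/-- The vectors `b_1, …, b_n` (indexed from `0`), numbered so that `(a_i, b_j) = δ_{ij}`. -/
def bVec {n : ℕ} (i : Fin n) : Std n := Pi.single (Sum.inr i.rev) 1

theorem stdForm_aVec_bVec (ε : ℤˣ) {n : ℕ} (i j : Fin n) :
    stdForm ε n (aVec i) (bVec j) = if i = j then 1 else 0 := by
  have h : (j = i) = (i = j) := propext eq_comm
  simp [stdForm, aVec, bVec, Matrix.toBilin'_single, antiDiag, h]

/-- The flag with `i`-th step spanned by `a_1, …, a_i` and `b_n, …, b_{n+1-i}`. -/
def stdFlag (n : ℕ) (i : Fin (n + 1)) : Submodule ℂ (Std n) :=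
  Submodule.span ℂ (aVec '' {j : Fin n | (j : ℕ) < i} ∪ bVec '' {j : Fin n | n ≤ (j : ℕ) + i})

/-! ### Adding `ℂ^{2n}` -/

section Stabilization

variable {V : Type*} [AddCommGroup V] [Module ℂ V]

/-- The orthogonal direct sum of `V` and `ℂ^{2n}`. -/
def sumForm (B : LinearMap.BilinForm ℂ V) (ε : ℤˣ) (n : ℕ) : LinearMap.BilinForm ℂ (V × Std n) :=
  B.compl₁₂ (LinearMap.fst ℂ V (Std n)) (LinearMap.fst ℂ V (Std n)) +
    (stdForm ε n).compl₁₂ (LinearMap.snd ℂ V (Std n)) (LinearMap.snd ℂ V (Std n))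

/-- `x ↦ x ⊕ e_ε`. -/
def iNil (n : ℕ) (x : Module.End ℂ V) : Module.End ℂ (V × Std n) :=
  LinearMap.prodMap x (stdNilp n)

/-- `F ↦ F ⊕ F_ε`, step by step. -/
def iFlag {n : ℕ} (F : Fin (n + 1) → Submodule ℂ V) : Fin (n + 1) → Submodule ℂ (V × Std n) :=
  fun i => (F i).prod (stdFlag n i)

/-- `(x, F) ↦ (x ⊕ e_ε, F ⊕ F_ε)`. -/
def iM {n : ℕ} (m : Pt n V) : Pt n (V × Std n) := (iNil n m.1, iFlag m.2)

end Stabilization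

end Nilcone

end

/-!
Let `s = (e, G)` be a flag `G` with a nilpotent `e` all of whose Jordan blocks have length `n`, so
that `G i = ker (e ^ i) = range (e ^ (n - i))`. If `y` maps each step of a flag `F`, running from
the zero subspace to the whole space in `n` steps, into the previous one, then
`range (y ^ (n - i)) ≤ F i ≤ ker (y ^ i)`. For `y = x ⊕ e` these inclusions give
`0 ⊕ G i ≤ F i ≤ V ⊕ G i`, so that `F i` is the direct sum of a subspace of `V` and of `G i`, and
`F` comes from a flag in `V`. Everything else about `F` can be checked on the two summands.

The inverse of `F ↦ F ⊕ G` projects subspaces to `V`. It is a morphism because the dimension of the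
projection is determined by that of the subspace: near a given frame, fixed entries of the projected
frame, selected by a nonvanishing determinant, form a basis of the projection.
-/

namespace Nilcone

section PolyFun

variable {E E' E'' : Type*} [AddCommGroup E] [Module ℂ E] [AddCommGroup E'] [Module ℂ E']
  [AddCommGroup E''] [Module ℂ E'']

/-- A polynomial map between complex vector spaces, characterised (without coordinates) by the
fact that it pulls polynomial functions back to polynomial functions. -/
def IsPolyMap (f : E → E') : Prop :=
  ∀ p ∈ polyFun E', p ∘ f ∈ polyFun E

theorem dual_mem_polyFun (l : Module.Dual ℂ E) : ⇑l ∈ polyFun E :=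
  Algebra.subset_adjoin ⟨l, rfl⟩

theorem isPolyMap_of_dual {f : E → E'} (h : ∀ l : Module.Dual ℂ E', l ∘ f ∈ polyFun E) :
    IsPolyMap f := by
  intro p hp
  induction hp using Algebra.adjoin_induction with
  | mem p hp =>
    obtain ⟨l, rfl⟩ := hp
    exact h l
  | algebraMap c => exact (polyFun E).algebraMap_mem c
  | add p q _ _ hp hq => exact add_mem hp hq
  | mul p q _ _ hp hq => exact mul_mem hp hq

theorem isPolyMap_linearMap (L : E →ₗ[ℂ] E') : IsPolyMap L :=
  isPolyMap_of_dual fun l => dual_mem_polyFun (l ∘ₗ L)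

theorem isPolyMap_const (c : E') : IsPolyMap fun _ : E => c :=
  isPolyMap_of_dual fun l => (polyFun E).algebraMap_mem (l c)

theorem IsPolyMap.comp {f : E → E'} {g : E' → E''} (hg : IsPolyMap g) (hf : IsPolyMap f) :
    IsPolyMap (g ∘ f) :=
  fun p hp => hf _ (hg p hp)

theorem IsPolyMap.prodMk {f : E → E'} {g : E → E''} (hf : IsPolyMap f) (hg : IsPolyMap g) :
    IsPolyMap fun e => (f e, g e) := by
  refine isPolyMap_of_dual fun l => ?_
  convert add_mem (hf _ (dual_mem_polyFun (l ∘ₗ LinearMap.inl ℂ E' E'')))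
    (hg _ (dual_mem_polyFun (l ∘ₗ LinearMap.inr ℂ E' E''))) using 1
  ext e
  simp [← map_add]

theorem isPolyMap_pi {ι : Type*} [Finite ι] {M : ι → Type*} [∀ i, AddCommGroup (M i)]
    [∀ i, Module ℂ (M i)] {f : E → (i : ι) → M i} (hf : ∀ i, IsPolyMap fun e => f e i) :
    IsPolyMap f := by
  classical
  have := Fintype.ofFinite ι
  refine isPolyMap_of_dual fun l => ?_
  convert sum_mem fun (i : ι) (_ : i ∈ Finset.univ) =>
    hf i _ (dual_mem_polyFun (l ∘ₗ LinearMap.single ℂ M i)) using 1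
  ext e
  simp [← map_sum, Finset.univ_sum_single]

theorem det_mem_polyFun {ι : Type*} [Fintype ι] [DecidableEq ι] {M : E → Matrix ι ι ℂ}
    (hM : ∀ i j, (fun e => M e i j) ∈ polyFun E) : (fun e => (M e).det) ∈ polyFun E := by
  have hterm (σ : Equiv.Perm ι) :
      ((Equiv.Perm.sign σ : ℤ) : E → ℂ) * ∏ i, (fun e => M e (σ i) i) ∈ polyFun E :=
    mul_mem (intCast_mem _ _) (prod_mem fun i _ => hM (σ i) i)
  convert sum_mem fun σ (_ : σ ∈ Finset.univ) => hterm σ using 1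
  ext e
  simp [Matrix.det_apply']

/-- A left inverse `r` of the tuple at `a` gives the determinant of `r ∘ w b` as witness. -/
theorem exists_polyFun_linearIndependent {ι : Type*} [Finite ι] (w : E →ₗ[ℂ] (ι → E')) {a : E}
    (ha : LinearIndependent ℂ (w a)) :
    ∃ q ∈ polyFun E, q a ≠ 0 ∧ ∀ b, q b ≠ 0 → LinearIndependent ℂ (w b) := by
  classical
  have := Fintype.ofFinite ι
  obtain ⟨r, hr⟩ := (Fintype.linearCombination ℂ (w a)).exists_leftInverse_of_injective
    (LinearMap.ker_eq_bot.2 (linearIndependent_iff_injective_fintypeLinearCombination.1 ha))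
  have hr_single (i : ι) : r (w a i) = Pi.single i 1 := by
    simpa using LinearMap.congr_fun hr (Pi.single i 1)
  let M (b : E) : Matrix ι ι ℂ := Matrix.of fun i => r (w b i)
  refine ⟨fun b => (M b).det, det_mem_polyFun fun i j => ?_, ?_, fun b hb => ?_⟩
  · exact dual_mem_polyFun (LinearMap.proj j ∘ₗ r ∘ₗ LinearMap.proj i ∘ₗ w)
  · have hM : M a = 1 := by
      ext i j
      simp [M, hr_single, Matrix.one_apply, Pi.single_apply, eq_comm]
    simp [hM]
  · exact (Matrix.linearIndependent_rows_of_det_ne_zero hb).of_comp r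

theorem exists_polyFun_span_comp_eq {ι : Type*} [Finite ι] (w : E →ₗ[ℂ] (ι → E')) (a : E) {k : ℕ}
    (hk : Module.finrank ℂ (Submodule.span ℂ (Set.range (w a))) = k) :
    ∃ σ : Fin k → ι, ∃ q ∈ polyFun E, q a ≠ 0 ∧ ∀ b, q b ≠ 0 →
      LinearIndependent ℂ (w b ∘ σ) ∧
      (Module.finrank ℂ (Submodule.span ℂ (Set.range (w b))) = k →
        Submodule.span ℂ (Set.range (w b ∘ σ)) = Submodule.span ℂ (Set.range (w b))) := by
  subst hk
  have hfin (b : E) := FiniteDimensional.span_of_finite ℂ (Set.finite_range (w b))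
  obtain ⟨c, hc_mem, -, hc⟩ := Submodule.exists_fun_fin_finrank_span_eq ℂ (Set.range (w a))
  choose σ hσ using hc_mem
  obtain rfl : w a ∘ σ = c := funext hσ
  obtain ⟨q, hq, hqa, hq_indep⟩ :=
    exists_polyFun_linearIndependent (LinearMap.funLeft ℂ E' σ ∘ₗ w) (a := a) hc
  refine ⟨σ, q, hq, hqa, fun b hb => ⟨hq_indep b hb, fun hrank => ?_⟩⟩
  refine Submodule.eq_of_le_of_finrank_eq (Submodule.span_mono (Set.range_comp_subset_range _ _)) ?_
  rw [hrank]
  exact (finrank_span_eq_card (hq_indep b hb)).trans (Fintype.card_fin _)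

end PolyFun

section Morphisms

variable {n : ℕ} {V V' V'' W : Type*} [AddCommGroup V] [Module ℂ V] [AddCommGroup V'] [Module ℂ V']
  [AddCommGroup V''] [Module ℂ V''] [AddCommGroup W] [Module ℂ W]

theorem isVarietyMorphism_of_lift {φ : Pt n V → Pt n V'} {Z : Set (Pt n V)} {Z' : Set (Pt n V')}
    (hφ : Set.MapsTo φ Z Z')
    (hlift : ∀ (D : Fin (n + 1) → ℕ) (a : PreFrame V D), IsFrame a → toPt a ∈ Z →
      ∃ (D' : Fin (n + 1) → ℕ) (ℓ : PreFrame V D → PreFrame V' D'), IsPolyMap ℓ ∧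
        ∃ q ∈ polyFun (PreFrame V D), q a ≠ 0 ∧
          ∀ b, IsFrame b → toPt b ∈ Z → q b ≠ 0 → IsFrame (ℓ b) ∧ toPt (ℓ b) = φ (toPt b)) :
    IsVarietyMorphism φ Z Z' := by
  refine ⟨hφ, fun U' hU' => ⟨⟨Set.inter_subset_left, fun D a ha haU => ?_⟩,
    fun f hf D a ha haU => ?_⟩⟩
  all_goals
    obtain ⟨D', ℓ, hℓ, q, hq, hqa, hlift⟩ := hlift D a ha haU.1
    obtain ⟨hℓa, hφa⟩ := hlift a ha haU.1 hqa
  · obtain ⟨q', hq', hqa', hU⟩ := hU'.2 D' _ hℓa (hφa ▸ haU.2)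
    refine ⟨q * q' ∘ ℓ, mul_mem hq (hℓ _ hq'), mul_ne_zero hqa hqa', fun b hb hbZ hqb => ⟨hbZ, ?_⟩⟩
    obtain ⟨hℓb, hφb⟩ := hlift b hb hbZ (left_ne_zero_of_mul hqb)
    rw [Set.mem_preimage, ← hφb]
    exact hU _ hℓb (hφb ▸ hφ hbZ) (right_ne_zero_of_mul hqb)
  · obtain ⟨p', hp', q', hq', hqa', hU⟩ := hf D' _ hℓa (hφa ▸ haU.2)
    refine ⟨q * p' ∘ ℓ, mul_mem hq (hℓ _ hp'), q * q' ∘ ℓ, mul_mem hq (hℓ _ hq'),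
      mul_ne_zero hqa hqa', fun b hb hbU hqb => ?_⟩
    obtain ⟨hℓb, hφb⟩ := hlift b hb hbU.1 (left_ne_zero_of_mul hqb)
    calc f (φ (toPt b)) = p' (ℓ b) / q' (ℓ b) :=
          hφb ▸ hU _ hℓb (hφb ▸ hbU.2) (right_ne_zero_of_mul hqb)
      _ = q b * p' (ℓ b) / (q b * q' (ℓ b)) :=
          (mul_div_mul_left _ _ (left_ne_zero_of_mul hqb)).symm

theorem IsVarietyMorphism.comp {φ : Pt n V → Pt n V'} {φ' : Pt n V' → Pt n V''}
    {Z : Set (Pt n V)} {Z' : Set (Pt n V')} {Z'' : Set (Pt n V'')}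
    (hφ' : IsVarietyMorphism φ' Z' Z'') (hφ : IsVarietyMorphism φ Z Z') :
    IsVarietyMorphism (φ' ∘ φ) Z Z'' := by
  refine ⟨hφ'.1.comp hφ.1, fun U hU => ?_⟩
  obtain ⟨hU', hreg'⟩ := hφ'.2 U hU
  obtain ⟨hU'', hreg⟩ := hφ.2 _ hU'
  have hpreimage : Z ∩ φ ⁻¹' (Z' ∩ φ' ⁻¹' U) = Z ∩ (φ' ∘ φ) ⁻¹' U :=
    Set.ext fun m => ⟨fun hm => ⟨hm.1, hm.2.2⟩, fun hm => ⟨hm.1, hφ.1 hm.1, hm.2⟩⟩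
  rw [hpreimage] at hU'' hreg
  exact ⟨hU'', fun f hf => hreg _ (hreg' f hf)⟩

theorem IsVarietyIso.comp {φ : Pt n V → Pt n V'} {φ' : Pt n V' → Pt n V''}
    {Z : Set (Pt n V)} {Z' : Set (Pt n V')} {Z'' : Set (Pt n V'')}
    (hφ' : IsVarietyIso φ' Z' Z'') (hφ : IsVarietyIso φ Z Z') :
    IsVarietyIso (φ' ∘ φ) Z Z'' := by
  obtain ⟨hφ, ψ, hψ, hinv⟩ := hφ
  obtain ⟨hφ', ψ', hψ', hinv'⟩ := hφ'
  exact ⟨hφ'.comp hφ, ψ ∘ ψ', hψ.comp hψ', hinv.comp hinv' hφ.1 hψ'.1⟩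

theorem IsFrame.finrank_toPt {D : Fin (n + 1) → ℕ} {b : PreFrame V D} (hb : IsFrame b)
    (i : Fin (n + 1)) : Module.finrank ℂ ((toPt b).2 i) = D i :=
  (finrank_span_eq_card (hb i)).trans (Fintype.card_fin _)

/-- The map of pairs (endomorphism, subspaces) given by a linear map `S` on endomorphisms and by
taking images of the subspaces under a linear map `T`. -/
def mapPt (S : Module.End ℂ V →ₗ[ℂ] Module.End ℂ V') (T : V →ₗ[ℂ] V') (m : Pt n V) : Pt n V' :=
  (S m.1, fun i => (m.2 i).map T)

/-- Near a frame `a`, a basis of `T (F i)` is given by fixed entries of the tuple `T ∘ b i`. -/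
theorem isVarietyMorphism_mapPt {S : Module.End ℂ V →ₗ[ℂ] Module.End ℂ V'} {T : V →ₗ[ℂ] V'}
    {Z : Set (Pt n V)} {Z' : Set (Pt n V')} (hmaps : Set.MapsTo (mapPt S T) Z Z')
    (hrank : ∀ m ∈ Z, ∀ m' ∈ Z, ∀ i, Module.finrank ℂ (m.2 i) = Module.finrank ℂ (m'.2 i) →
      Module.finrank ℂ ((m.2 i).map T) = Module.finrank ℂ ((m'.2 i).map T)) :
    IsVarietyMorphism (mapPt S T) Z Z' := by
  refine isVarietyMorphism_of_lift hmaps fun D a ha haZ => ?_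
  let w (i : Fin (n + 1)) : PreFrame V D →ₗ[ℂ] (Fin (D i) → V') :=
    T.compLeft (Fin (D i)) ∘ₗ LinearMap.proj i ∘ₗ LinearMap.snd ℂ _ _
  have hspan (b : PreFrame V D) (i) :
      ((toPt b).2 i).map T = Submodule.span ℂ (Set.range (w i b)) := by
    rw [toPt, Submodule.map_span, ← Set.range_comp]
    rfl
  choose σ q hq hqa hσ using fun i => exists_polyFun_span_comp_eq (w i) a rfl
  refine ⟨_, fun b => (S b.1, fun i => w i b ∘ σ i), ?_, ∏ i, q i,
    prod_mem fun i _ => hq i, ?_, fun b hb hbZ hqb => ?_⟩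
  · exact (isPolyMap_linearMap (S ∘ₗ LinearMap.fst ℂ _ _)).prodMk <| isPolyMap_pi fun i =>
      isPolyMap_linearMap (LinearMap.funLeft ℂ V' (σ i) ∘ₗ w i)
  · rw [Finset.prod_apply]
    exact Finset.prod_ne_zero_iff.2 fun i _ => hqa i
  · rw [Finset.prod_apply, Finset.prod_ne_zero_iff] at hqb
    have hσb (i) := hσ i b (hqb i (Finset.mem_univ i))
    refine ⟨fun i => (hσb i).1, Prod.ext rfl (funext fun i => ?_)⟩
    refine ((hσb i).2 ?_).trans (hspan b i).symm
    rw [← hspan, ← hspan]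
    exact hrank _ hbZ _ haZ i ((hb.finrank_toPt i).trans (ha.finrank_toPt i).symm)

/-- The action of a linear isomorphism on pairs (endomorphism, subspaces). -/
def transport (g : V ≃ₗ[ℂ] V') : Pt n V → Pt n V' :=
  mapPt g.conj.toLinearMap g.toLinearMap

theorem transport_symm_transport (g : V ≃ₗ[ℂ] V') (m : Pt n V) :
    transport g.symm (transport g m) = m := by
  refine Prod.ext (LinearMap.ext fun v => ?_) (funext fun i => ?_)
  · simp [transport, mapPt, LinearEquiv.conj_apply]
  · simp [transport, mapPt, ← Submodule.map_comp]

theorem isVarietyMorphism_transport (g : V ≃ₗ[ℂ] V') {Z : Set (Pt n V)} {Z' : Set (Pt n V')}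
    (h : Set.MapsTo (transport g) Z Z') : IsVarietyMorphism (transport g) Z Z' :=
  isVarietyMorphism_mapPt h fun _ _ _ _ _ hm =>
    (g.finrank_map_eq _).trans (hm.trans (g.finrank_map_eq _).symm)

theorem isVarietyIso_transport (g : V ≃ₗ[ℂ] V') {Z : Set (Pt n V)} {Z' : Set (Pt n V')}
    (h : Set.MapsTo (transport g) Z Z') (h' : Set.MapsTo (transport g.symm) Z' Z) :
    IsVarietyIso (transport g) Z Z' :=
  ⟨isVarietyMorphism_transport g h, transport g.symm, isVarietyMorphism_transport g.symm h',
    fun m _ => transport_symm_transport g m, fun m _ => transport_symm_transport g.symm m⟩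

/-- The direct sum, step by step, with a fixed pair `s` of an endomorphism and a flag. -/
def addSummand (s : Pt n W) (m : Pt n V) : Pt n (V × W) :=
  (m.1.prodMap s.1, fun i => (m.2 i).prod (s.2 i))

/-- The compression of an endomorphism to the first summand, and the projections of the subspaces;
this is a left inverse of `addSummand s`. -/
def projFst : Pt n (V × W) → Pt n V :=
  mapPt (((LinearMap.fst ℂ V W).compRight ℂ) ∘ₗ (LinearMap.inl ℂ V W).lcomp ℂ (V × W))
    (LinearMap.fst ℂ V W)

theorem projFst_addSummand (s : Pt n W) (m : Pt n V) : projFst (addSummand s m) = m := by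
  refine Prod.ext (LinearMap.ext fun v => ?_) (funext fun i => ?_)
  · simp [projFst, mapPt, addSummand]
  · exact Submodule.prod_map_fst _ _

theorem addSummand_injective (s : Pt n W) :
    Function.Injective (addSummand s : Pt n V → Pt n (V × W)) :=
  Function.LeftInverse.injective (projFst_addSummand s)

theorem exists_isFrame_toPt_eq [FiniteDimensional ℂ W] (s : Pt n W) :
    ∃ (D : Fin (n + 1) → ℕ) (c : PreFrame W D), IsFrame c ∧ toPt c = s := by
  let β (i) := Module.finBasis ℂ (s.2 i)
  refine ⟨_, (s.1, fun i => (s.2 i).subtype ∘ β i),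
    fun i => (β i).linearIndependent.map' _ (s.2 i).ker_subtype, Prod.ext rfl (funext fun i => ?_)⟩
  simp only [toPt, Set.range_comp, ← Submodule.map_span, (β i).span_eq, Submodule.map_subtype_top]

theorem isVarietyMorphism_addSummand [FiniteDimensional ℂ W] (s : Pt n W) {Z : Set (Pt n V)}
    {Z' : Set (Pt n (V × W))} (h : Set.MapsTo (addSummand s) Z Z') :
    IsVarietyMorphism (addSummand s) Z Z' := by
  obtain ⟨D', c, hc, rfl⟩ := exists_isFrame_toPt_eq s
  refine isVarietyMorphism_of_lift h fun D a _ _ => ⟨fun i => D i + D' i, fun b =>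
    (b.1.prodMap c.1, fun i =>
      Sum.elim (LinearMap.inl ℂ V W ∘ b.2 i) (LinearMap.inr ℂ V W ∘ c.2 i) ∘ finSumFinEquiv.symm),
    ?_, 1, one_mem _, one_ne_zero,
    fun b hb _ _ => ⟨fun i => ?_, Prod.ext rfl (funext fun i => ?_)⟩⟩
  · let endo : PreFrame V D →ₗ[ℂ] Module.End ℂ V := LinearMap.fst ℂ _ _
    let vectors : PreFrame V D →ₗ[ℂ] ((i : Fin (n + 1)) → Fin (D i) → V) := LinearMap.snd ℂ _ _
    have hentry (i) (j) : IsPolyMap fun b : PreFrame V D => LinearMap.inl ℂ V W (b.2 i j) :=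
      isPolyMap_linearMap (LinearMap.inl ℂ V W ∘ₗ LinearMap.proj j ∘ₗ LinearMap.proj i ∘ₗ vectors)
    refine .prodMk ?_ (isPolyMap_pi fun i => isPolyMap_pi fun j => ?_)
    · exact (isPolyMap_linearMap (LinearMap.prodMapLinear ℂ V W V W ℂ)).comp
        ((isPolyMap_linearMap endo).prodMk (isPolyMap_const c.1))
    · simp only [Function.comp_apply]
      cases finSumFinEquiv.symm j with
      | inl j => exact hentry i j
      | inr j => exact isPolyMap_const _
  · exact (linearIndependent_inl_union_inr' (hb i) (hc i)).comp _ finSumFinEquiv.symm.injective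
  · simp only [toPt, addSummand, Set.range_comp _ finSumFinEquiv.symm, Equiv.range_eq_univ,
      Set.image_univ, Set.Sum.elim_range, Set.range_comp, LinearMap.span_inl_union_inr]

theorem finrank_submodule_prod {K M N : Type*} [Field K] [AddCommGroup M] [Module K M]
    [AddCommGroup N] [Module K N] (p : Submodule K M) (q : Submodule K N) [FiniteDimensional K p]
    [FiniteDimensional K q] :
    Module.finrank K (p.prod q) = Module.finrank K p + Module.finrank K q := by
  rw [← Module.finrank_prod, ← LinearMap.finrank_range_of_inj
    (f := p.subtype.prodMap q.subtype) (p.subtype_injective.prodMap q.subtype_injective),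
    LinearMap.range_prodMap, p.range_subtype, q.range_subtype]

theorem isVarietyIso_addSummand [FiniteDimensional ℂ V] [FiniteDimensional ℂ W] (s : Pt n W)
    {Z : Set (Pt n V)} {Z' : Set (Pt n (V × W))} (h : addSummand s '' Z = Z') :
    IsVarietyIso (addSummand s) Z Z' := by
  subst h
  refine ⟨isVarietyMorphism_addSummand s (Set.mapsTo_image _ _), projFst,
    isVarietyMorphism_mapPt ?_ ?_, fun m _ => projFst_addSummand s m, ?_⟩
  · rintro _ ⟨m, hm, rfl⟩
    exact (congrArg (· ∈ Z) (projFst_addSummand s m)).mpr hm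
  · rintro _ ⟨m, -, rfl⟩ _ ⟨m', -, rfl⟩ i hm
    rw [addSummand, addSummand, Submodule.prod_map_fst, Submodule.prod_map_fst]
    rw [addSummand, addSummand, finrank_submodule_prod, finrank_submodule_prod] at hm
    exact Nat.add_right_cancel hm
  · rintro _ ⟨m, -, rfl⟩
    rw [projFst_addSummand]

end Morphisms

section Products

variable {R M N : Type*} [Semiring R] [AddCommMonoid M] [Module R M] [AddCommMonoid N] [Module R N]

theorem prodMap_pow (x : Module.End R M) (y : Module.End R N) (k : ℕ) :
    x.prodMap y ^ k = (x ^ k).prodMap (y ^ k) :=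
  (map_pow (LinearMap.prodMapRingHom R M N) (x, y) k).symm

theorem prodMap_inj {x x' : Module.End R M} {y y' : Module.End R N} :
    x.prodMap y = x'.prodMap y' ↔ x = x' ∧ y = y' := by
  refine ⟨fun h => ⟨LinearMap.ext fun u => ?_, LinearMap.ext fun v => ?_⟩,
    fun h => h.1 ▸ h.2 ▸ rfl⟩
  · exact congrArg Prod.fst (LinearMap.congr_fun h (u, 0))
  · exact congrArg Prod.snd (LinearMap.congr_fun h (0, v))

theorem submodule_prod_le_prod_iff {p p' : Submodule R M} {q q' : Submodule R N} :
    p.prod q ≤ p'.prod q' ↔ p ≤ p' ∧ q ≤ q' := by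
  rw [Submodule.le_prod_iff, Submodule.prod_map_fst, Submodule.prod_map_snd]

theorem submodule_prod_inj {p p' : Submodule R M} {q q' : Submodule R N} :
    p.prod q = p'.prod q' ↔ p = p' ∧ q = q' := by
  simp only [le_antisymm_iff, submodule_prod_le_prod_iff]
  tauto

theorem map_fst_prod_eq_self {R M N : Type*} [Ring R] [AddCommGroup M] [Module R M] [AddCommGroup N]
    [Module R N] {p : Submodule R (M × N)} {q : Submodule R N}
    (hsnd : p.map (LinearMap.snd R M N) ≤ q) (hinr : q.map (LinearMap.inr R M N) ≤ p) :
    (p.map (LinearMap.fst R M N)).prod q = p := by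
  refine le_antisymm ?_ ((Submodule.le_prod_iff ..).2 ⟨le_rfl, hsnd⟩)
  rintro ⟨u, v⟩ ⟨⟨⟨u, v'⟩, huv', rfl⟩, hv⟩
  have hdiff : (0, v - v') ∈ p :=
    hinr (Submodule.mem_map_of_mem (sub_mem hv (hsnd (Submodule.mem_map_of_mem huv'))))
  simpa using add_mem huv' hdiff

end Products

section Flags

variable {R M : Type*} [Semiring R] [AddCommMonoid M] [Module R M] {n : ℕ}
  {F : Fin (n + 1) → Submodule R M} {f : Module.End R M}

theorem flag_le_ker_pow (h_zero : F 0 = ⊥) (hf : ∀ i : Fin n, (F i.succ).map f ≤ F i.castSucc)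
    (i : Fin (n + 1)) : F i ≤ LinearMap.ker (f ^ (i : ℕ)) := by
  induction i using Fin.induction with
  | zero => exact h_zero ▸ bot_le
  | succ i ih =>
    intro v hv
    rw [LinearMap.mem_ker, Fin.val_succ, pow_succ, Module.End.mul_apply]
    exact ih (hf i ⟨v, hv, rfl⟩)

theorem range_pow_le_flag (h_last : F (Fin.last n) = ⊤)
    (hf : ∀ i : Fin n, (F i.succ).map f ≤ F i.castSucc) (i : Fin (n + 1)) :
    LinearMap.range (f ^ (i.rev : ℕ)) ≤ F i := by
  induction i using Fin.reverseInduction with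
  | last => exact h_last ▸ le_top
  | cast i ih =>
    rintro _ ⟨v, rfl⟩
    rw [Fin.rev_castSucc, Fin.val_succ, pow_succ', Module.End.mul_apply]
    exact hf i ⟨_, ih ⟨v, by rw [Fin.rev_succ, Fin.val_castSucc]⟩, rfl⟩

end Flags

section OrthSum

variable {R M N : Type*} [CommRing R] [AddCommGroup M] [Module R M] [AddCommGroup N] [Module R N]
  {B : LinearMap.BilinForm R M} {C : LinearMap.BilinForm R N}

/-- The orthogonal direct sum of two bilinear forms. -/
def orthSum (B : LinearMap.BilinForm R M) (C : LinearMap.BilinForm R N) :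
    LinearMap.BilinForm R (M × N) :=
  B.compl₁₂ (LinearMap.fst R M N) (LinearMap.fst R M N) +
    C.compl₁₂ (LinearMap.snd R M N) (LinearMap.snd R M N)

theorem orthSum_apply (u v : M × N) : orthSum B C u v = B u.1 v.1 + C u.2 v.2 := rfl

theorem orthSum_separatingRight (hB : B.SeparatingRight) (hC : C.SeparatingRight) :
    (orthSum B C).SeparatingRight := fun v hv => Prod.ext
  (hB _ fun u => by simpa [orthSum_apply] using hv (u, 0))
  (hC _ fun u => by simpa [orthSum_apply] using hv (0, u))

theorem isSkewAdjoint_prodMap_iff {x : Module.End R M} {y : Module.End R N} :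
    (orthSum B C).IsSkewAdjoint (x.prodMap y) ↔ B.IsSkewAdjoint x ∧ C.IsSkewAdjoint y := by
  simp only [LinearMap.IsSkewAdjoint, LinearMap.IsAdjointPair, orthSum_apply]
  refine ⟨fun h => ⟨fun u v => ?_, fun u v => ?_⟩, fun h u v => ?_⟩
  · simpa using h (u, 0) (v, 0)
  · simpa using h (0, u) (0, v)
  · exact congrArg₂ _ (h.1 u.1 v.1) (h.2 u.2 v.2)

theorem orthogonal_orthSum_prod (p : Submodule R M) (q : Submodule R N) :
    (orthSum B C).orthogonal (p.prod q) = (B.orthogonal p).prod (C.orthogonal q) := by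
  ext v
  simp only [LinearMap.BilinForm.mem_orthogonal_iff, Submodule.mem_prod, orthSum_apply]
  refine ⟨fun h => ⟨fun u hu => ?_, fun u hu => ?_⟩, fun h u hu => ?_⟩
  · simpa using h (u, 0) ⟨hu, zero_mem _⟩
  · simpa using h (0, u) ⟨zero_mem _, hu⟩
  · rw [h.1 _ hu.1, h.2 _ hu.2, add_zero]

end OrthSum

section SkewAdjoint

variable {R M : Type*} [CommRing R] [AddCommGroup M] [Module R M] {B : LinearMap.BilinForm R M}

theorem ker_neg_pow (f : Module.End R M) (k : ℕ) :
    LinearMap.ker ((-f) ^ k) = LinearMap.ker (f ^ k) := by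
  rcases k.even_or_odd with hk | hk
  · rw [hk.neg_pow]
  · rw [hk.neg_pow, LinearMap.ker_neg]

theorem isAdjointPair_pow {f g : Module.End R M} (h : B.IsAdjointPair B f g) (k : ℕ) :
    B.IsAdjointPair B ⇑(f ^ k) ⇑(g ^ k) := by
  induction k with
  | zero => exact LinearMap.isAdjointPair_one
  | succ k ih =>
    rw [pow_succ, pow_succ']
    exact ih.mul h

theorem orthogonal_range_of_isAdjointPair (hB : B.SeparatingRight) {f g : Module.End R M}
    (h : B.IsAdjointPair B f g) : B.orthogonal (LinearMap.range f) = LinearMap.ker g := by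
  ext v
  simp only [LinearMap.BilinForm.mem_orthogonal_iff, LinearMap.mem_range,
    forall_exists_index, forall_apply_eq_imp_iff, LinearMap.mem_ker, h _ v]
  exact ⟨hB _, fun hv u => by rw [hv, map_zero]⟩

theorem orthogonal_range_pow (hB : B.SeparatingRight) {f : Module.End R M}
    (hf : B.IsSkewAdjoint f) (k : ℕ) :
    B.orthogonal (LinearMap.range (f ^ k)) = LinearMap.ker (f ^ k) :=
  (orthogonal_range_of_isAdjointPair hB (isAdjointPair_pow (g := -f) hf k)).trans
    (ker_neg_pow f k)

end SkewAdjoint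

section CotangentFlags

variable {V W : Type*} [AddCommGroup V] [Module ℂ V] [AddCommGroup W] [Module ℂ W]
  {B : LinearMap.BilinForm ℂ V} {C : LinearMap.BilinForm ℂ W} {n : ℕ} {ε : ℤˣ}

theorem IsEpsForm.of_separatingRight (hsep : B.SeparatingRight)
    (hsymm : ∀ u v, B u v = ((ε : ℤ) : ℂ) * B v u) : IsEpsForm ε B :=
  ⟨⟨fun u hu => hsep u fun v => by rw [hsymm, hu, mul_zero], hsep⟩, hsymm⟩

theorem isEpsForm_orthSum (hB : IsEpsForm ε B) (hC : IsEpsForm ε C) :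
    IsEpsForm ε (orthSum B C) := by
  refine .of_separatingRight (orthSum_separatingRight hB.1.2 hC.1.2) fun u v => ?_
  rw [orthSum_apply, orthSum_apply, hB.2, hC.2, mul_add]

theorem mem_nilcone_iff {x : Module.End ℂ V} :
    x ∈ nilcone B n ↔ B.IsSkewAdjoint x ∧ x ^ n = 0 := by
  have hskew : x ∈ skewAdjointLieSubalgebra B ↔ B.IsSkewAdjoint x :=
    LinearMap.mem_skewAdjointSubmodule x
  rw [← hskew]
  exact ⟨fun h => ⟨h.1, h.2.2⟩, fun h => ⟨h.1, ⟨n, h.2⟩, h.2⟩⟩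

theorem prodMap_mem_nilcone_iff {x : Module.End ℂ V} {y : Module.End ℂ W} :
    x.prodMap y ∈ nilcone (orthSum B C) n ↔ x ∈ nilcone B n ∧ y ∈ nilcone C n := by
  have hzero : x.prodMap y ^ n = 0 ↔ x ^ n = 0 ∧ y ^ n = 0 := by
    rw [prodMap_pow, ← LinearMap.prodMap_zero, prodMap_inj]
  rw [mem_nilcone_iff, mem_nilcone_iff, mem_nilcone_iff, isSkewAdjoint_prodMap_iff, hzero]
  exact and_and_and_comm

theorem prod_mem_isotropicFlags_iff {F : Fin (n + 1) → Submodule ℂ V}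
    {G : Fin (n + 1) → Submodule ℂ W} :
    (fun i => (F i).prod (G i)) ∈ isotropicFlags (orthSum B C) n ↔
      F ∈ isotropicFlags B n ∧ G ∈ isotropicFlags C n := by
  simp only [isotropicFlags, Set.mem_ofPred_eq, Monotone, orthogonal_orthSum_prod,
    ← Submodule.prod_bot, ← Submodule.prod_top, submodule_prod_inj, submodule_prod_le_prod_iff,
    imp_and, forall_and]
  tauto

theorem addSummand_mem_cotangentFlags_iff {s : Pt n W} {m : Pt n V} :
    addSummand s m ∈ cotangentFlags (orthSum B C) n ↔
      m ∈ cotangentFlags B n ∧ s ∈ cotangentFlags C n := by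
  have hmap : (∀ i : Fin n, ((addSummand s m).2 i.succ).map (addSummand s m).1 ≤
      (addSummand s m).2 i.castSucc) ↔
      (∀ i : Fin n, (m.2 i.succ).map m.1 ≤ m.2 i.castSucc) ∧
      ∀ i : Fin n, (s.2 i.succ).map s.1 ≤ s.2 i.castSucc := by
    simp only [addSummand, Submodule.map_le_iff_le_comap, LinearMap.prodMap_comap_prod,
      submodule_prod_le_prod_iff, forall_and]
  refine (and_congr prodMap_mem_nilcone_iff
    (and_congr prod_mem_isotropicFlags_iff hmap)).trans ?_
  simp only [cotangentFlags, Set.mem_ofPred_eq]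
  tauto

end CotangentFlags

section Rectangular

variable {V W : Type*} [AddCommGroup V] [Module ℂ V] [AddCommGroup W] [Module ℂ W]
  {B : LinearMap.BilinForm ℂ V} {C : LinearMap.BilinForm ℂ W} {n r : ℕ} {s : Pt n W}

/-- The endomorphism `s.1` is nilpotent of rectangular type, with `r` Jordan blocks all of length
`n`, and `s.2` is the flag of the kernels of its powers. Jordan types are encoded by the dimensions
of these kernels. -/
structure IsRectangular (r : ℕ) (s : Pt n W) : Prop where
  pow_eq_zero : s.1 ^ n = 0
  ker_pow : ∀ i : Fin (n + 1), LinearMap.ker (s.1 ^ (i : ℕ)) = s.2 i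
  finrank_eq : ∀ i : Fin (n + 1), Module.finrank ℂ (s.2 i) = r * i

namespace IsRectangular

theorem zero_eq_bot (hs : IsRectangular r s) : s.2 0 = ⊥ :=
  (hs.ker_pow 0).symm.trans LinearMap.ker_id

theorem last_eq_top (hs : IsRectangular r s) : s.2 (Fin.last n) = ⊤ := by
  rw [← hs.ker_pow, Fin.val_last, hs.pow_eq_zero, LinearMap.ker_zero]

theorem finrank_ker_pow (hs : IsRectangular r s) (k : ℕ) :
    Module.finrank ℂ (LinearMap.ker (s.1 ^ k)) = r * min k n := by
  rcases le_total k n with hk | hk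
  · rw [min_eq_left hk]
    rw [← hs.finrank_eq ⟨k, by lia⟩, ← hs.ker_pow]
  · rw [min_eq_right hk, pow_eq_zero_of_le hk hs.pow_eq_zero, LinearMap.ker_zero,
      ← hs.last_eq_top, hs.finrank_eq, Fin.val_last]

theorem range_pow [FiniteDimensional ℂ W] (hs : IsRectangular r s) (i : Fin (n + 1)) :
    LinearMap.range (s.1 ^ (i.rev : ℕ)) = s.2 i := by
  have hi : (i : ℕ) + i.rev = n := by grind
  refine Submodule.eq_of_le_of_finrank_eq ?_ ?_
  · rw [← hs.ker_pow, LinearMap.range_le_ker_iff, ← Module.End.mul_eq_comp, ← pow_add]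
    exact (congrArg (s.1 ^ ·) hi).trans hs.pow_eq_zero
  · have hrank := (s.1 ^ (i.rev : ℕ)).finrank_range_add_finrank_ker
    rw [hs.ker_pow, hs.finrank_eq, ← finrank_top ℂ W, ← hs.last_eq_top, hs.finrank_eq,
      Fin.val_last] at hrank
    rw [hs.finrank_eq]
    have := congrArg (r * ·) hi
    simp only [mul_add] at this
    lia

theorem mem_cotangentFlags [FiniteDimensional ℂ W] (hs : IsRectangular r s)
    (hC : C.SeparatingRight) (hskew : C.IsSkewAdjoint s.1) : s ∈ cotangentFlags C n := by
  refine ⟨mem_nilcone_iff.2 ⟨hskew, hs.pow_eq_zero⟩,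
    ⟨hs.zero_eq_bot, hs.last_eq_top, fun i j hij => ?_, fun i => ?_⟩, fun i => ?_⟩
  · rw [← hs.ker_pow, ← hs.ker_pow, ← Nat.sub_add_cancel hij, pow_add]
    exact LinearMap.ker_le_ker_comp _ _
  · rw [← hs.range_pow, orthogonal_range_pow hC hskew, hs.ker_pow]
  · rw [← hs.ker_pow, ← hs.ker_pow, Submodule.map_le_iff_le_comap, Fin.val_succ, pow_succ]
    exact (LinearMap.ker_comp _ _).le

/-- Such a flag `m.2` lies between `0 ⊕ s.2` and `V ⊕ s.2`, the flags of ranges and of kernels of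
the powers of `s.1` being the same. -/
theorem addSummand_projFst [FiniteDimensional ℂ W] (hs : IsRectangular r s)
    {x : Module.End ℂ V} {m : Pt n (V × W)} (hm : m.1 = x.prodMap s.1) (h_zero : m.2 0 = ⊥)
    (h_last : m.2 (Fin.last n) = ⊤)
    (h_map : ∀ i : Fin n, (m.2 i.succ).map m.1 ≤ m.2 i.castSucc) :
    addSummand s (projFst m) = m := by
  have hsnd (i) : (m.2 i).map (LinearMap.snd ℂ V W) ≤ s.2 i := by
    rw [← hs.ker_pow]
    refine (Submodule.map_mono (flag_le_ker_pow h_zero h_map i)).trans ?_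
    rw [hm, prodMap_pow, LinearMap.ker_prodMap, Submodule.prod_map_snd]
  have hinr (i) : (s.2 i).map (LinearMap.inr ℂ V W) ≤ m.2 i := by
    rw [← hs.range_pow]
    refine le_trans ?_ (range_pow_le_flag h_last h_map i)
    rw [hm, prodMap_pow, LinearMap.range_prodMap, Submodule.map_inr]
    exact Submodule.prod_mono bot_le le_rfl
  refine Prod.ext ?_ (funext fun i => map_fst_prod_eq_self (hsnd i) (hinr i))
  rw [hm]
  exact prodMap_inj.2 ⟨LinearMap.ext fun v => by simp [projFst, mapPt, hm], rfl⟩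

theorem mem_image_addSummand_fiber [FiniteDimensional ℂ W] (hs : IsRectangular r s)
    {x : Module.End ℂ V} {m : Pt n (V × W)} (hm : m ∈ fiber (orthSum B C) n (x.prodMap s.1)) :
    m ∈ addSummand s '' fiber B n x := by
  obtain ⟨hm_mem, hm_proj⟩ := hm
  have hsplit : addSummand s (projFst m) = m :=
    hs.addSummand_projFst hm_proj hm_mem.2.1.1 hm_mem.2.1.2.1 hm_mem.2.2
  refine ⟨projFst m, ⟨(addSummand_mem_cotangentFlags_iff.1 (hsplit.symm ▸ hm_mem)).1, ?_⟩, hsplit⟩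
  exact (prodMap_inj.1 ((congrArg Prod.fst hsplit).trans hm_proj)).1

theorem image_addSummand_fiber [FiniteDimensional ℂ W] (hs : IsRectangular r s)
    (hmem : s ∈ cotangentFlags C n) (x : Module.End ℂ V) :
    addSummand s '' fiber B n x = fiber (orthSum B C) n (x.prodMap s.1) := by
  refine Set.Subset.antisymm ?_ fun m hm => hs.mem_image_addSummand_fiber hm
  rintro _ ⟨m, ⟨hm, rfl⟩, rfl⟩
  exact ⟨addSummand_mem_cotangentFlags_iff.2 ⟨hm, hmem⟩, rfl⟩

theorem image_addSummand_cotangentFlags [FiniteDimensional ℂ W] (hs : IsRectangular r s)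
    (hmem : s ∈ cotangentFlags C n) :
    addSummand s '' cotangentFlags B n = {m' | m' ∈ cotangentFlags (orthSum B C) n ∧
      proj m' ∈ (fun x => x.prodMap s.1) '' nilcone B n} := by
  refine Set.Subset.antisymm ?_ ?_
  · rintro _ ⟨m, hm, rfl⟩
    exact ⟨addSummand_mem_cotangentFlags_iff.2 ⟨hm, hmem⟩, m.1, hm.1, rfl⟩
  · rintro m' ⟨hm', x, -, hx⟩
    exact Set.image_mono (fun _ hm => hm.1) (hs.mem_image_addSummand_fiber ⟨hm', hx.symm⟩)

variable [FiniteDimensional ℂ V] [FiniteDimensional ℂ W]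

theorem finrank_ker_prodMap_pow (hs : IsRectangular r s) (x : Module.End ℂ V) (k : ℕ) :
    Module.finrank ℂ (LinearMap.ker (x.prodMap s.1 ^ k)) =
      Module.finrank ℂ (LinearMap.ker (x ^ k)) + r * min k n := by
  rw [prodMap_pow, LinearMap.ker_prodMap, finrank_submodule_prod, hs.finrank_ker_pow]

theorem hasDims_addSummand_iff (hs : IsRectangular r s) {m : Pt n V} {d : Fin n → ℕ} :
    HasDims (addSummand s m).2 (fun i => d i + r) ↔ HasDims m.2 d := by
  refine forall_congr' fun i => ?_
  rw [addSummand, finrank_submodule_prod, finrank_submodule_prod, hs.finrank_eq, hs.finrank_eq,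
    Fin.val_succ, Fin.val_castSucc, mul_add_one]
  lia

theorem image_addSummand_spaltenstein (hs : IsRectangular r s) (hmem : s ∈ cotangentFlags C n)
    (d : Fin n → ℕ) (x : Module.End ℂ V) :
    addSummand s '' spaltenstein B d x =
      spaltenstein (orthSum B C) (fun i => d i + r) (x.prodMap s.1) := by
  have hdims : {m : Pt n V | HasDims m.2 d} =
      addSummand s ⁻¹' {m | HasDims m.2 fun i => d i + r} :=
    Set.ext fun _ => hs.hasDims_addSummand_iff.symm
  calc addSummand s '' spaltenstein B d x
      = addSummand s '' (fiber B n x ∩ addSummand s ⁻¹' {m | HasDims m.2 fun i => d i + r}) :=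
        congrArg (fun Y => addSummand s '' (fiber B n x ∩ Y)) hdims
    _ = fiber (orthSum B C) n (x.prodMap s.1) ∩ {m | HasDims m.2 fun i => d i + r} := by
        rw [Set.image_inter_preimage, hs.image_addSummand_fiber hmem]

end IsRectangular

end Rectangular

section Isometry

variable {n : ℕ} {V V' : Type*} [AddCommGroup V] [Module ℂ V] [AddCommGroup V'] [Module ℂ V']
  {B : LinearMap.BilinForm ℂ V} {B' : LinearMap.BilinForm ℂ V'} {g : V ≃ₗ[ℂ] V'}

theorem conj_mem_nilcone (hg : ∀ u v, B' (g u) (g v) = B u v) {x : Module.End ℂ V}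
    (hx : x ∈ nilcone B n) : g.conj x ∈ nilcone B' n := by
  obtain ⟨hskew, hpow⟩ := mem_nilcone_iff.1 hx
  refine mem_nilcone_iff.2 ⟨fun u v => ?_, ?_⟩
  · obtain ⟨u, rfl⟩ := g.surjective u
    obtain ⟨v, rfl⟩ := g.surjective v
    simpa [LinearEquiv.conj_apply_apply, ← map_neg, hg] using hskew u v
  · exact (map_pow (g.conjAlgEquiv ℂ) x n).symm.trans (by rw [hpow, map_zero])

theorem orthogonal_map_isometry (hg : ∀ u v, B' (g u) (g v) = B u v) (p : Submodule ℂ V) :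
    B'.orthogonal (p.map g.toLinearMap) = (B.orthogonal p).map g.toLinearMap := by
  ext v
  obtain ⟨v, rfl⟩ := g.surjective v
  simp only [LinearMap.BilinForm.mem_orthogonal_iff, Submodule.mem_map, LinearEquiv.coe_coe,
    forall_exists_index, and_imp, forall_apply_eq_imp_iff₂, hg, g.injective.eq_iff,
    exists_eq_right]

theorem map_mem_isotropicFlags (hg : ∀ u v, B' (g u) (g v) = B u v)
    {F : Fin (n + 1) → Submodule ℂ V} (hF : F ∈ isotropicFlags B n) :
    (fun i => (F i).map g.toLinearMap) ∈ isotropicFlags B' n := by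
  obtain ⟨h_zero, h_last, hmono, horth⟩ := hF
  refine ⟨?_, ?_, fun i j hij => Submodule.map_mono (hmono hij), fun i => ?_⟩
  · exact (congrArg _ h_zero).trans (Submodule.map_bot _)
  · exact (congrArg _ h_last).trans ((Submodule.map_top _).trans g.range)
  · rw [orthogonal_map_isometry hg, horth]

theorem mapsTo_transport_spaltenstein (hg : ∀ u v, B' (g u) (g v) = B u v) (d : Fin n → ℕ)
    (x : Module.End ℂ V) :
    Set.MapsTo (transport g) (spaltenstein B d x) (spaltenstein B' d (g.conj x)) := by
  rintro m ⟨⟨⟨hx, hF, hmap⟩, rfl⟩, hd⟩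
  refine ⟨⟨⟨conj_mem_nilcone hg hx, map_mem_isotropicFlags hg hF, fun i => ?_⟩, rfl⟩, fun i => ?_⟩
  · rintro _ ⟨_, ⟨v, hv, rfl⟩, rfl⟩
    exact ⟨m.1 v, hmap i ⟨v, hv, rfl⟩, by simp [transport, mapPt]⟩
  · exact (g.finrank_map_eq _).trans ((hd i).trans (congrArg (· + d i) (g.finrank_map_eq _).symm))

theorem isVarietyIso_transport_spaltenstein (hg : ∀ u v, B' (g u) (g v) = B u v) (d : Fin n → ℕ)
    (x : Module.End ℂ V) :
    IsVarietyIso (transport g) (spaltenstein B d x) (spaltenstein B' d (g.conj x)) := by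
  refine isVarietyIso_transport g (mapsTo_transport_spaltenstein hg d x) ?_
  have hg_symm (u v) : B (g.symm u) (g.symm v) = B' u v := by
    rw [← hg, g.apply_symm_apply, g.apply_symm_apply]
  have hconj : g.symm.conj (g.conj x) = x := LinearMap.ext fun v => by simp
  simpa only [hconj] using mapsTo_transport_spaltenstein hg_symm d (g.conj x)

end Isometry

section Std

open Matrix

variable {n : ℕ}

theorem antiDiag_mul_apply (A : Matrix (Fin n) (Fin n) ℂ) (i j : Fin n) :
    (antiDiag n * A) i j = A i.rev j := by
  simp [antiDiag, mul_apply]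

theorem antiDiag_mul_self : antiDiag n * antiDiag n = 1 := by
  ext i j
  rw [antiDiag_mul_apply]
  simp [antiDiag, one_apply, eq_comm]

theorem antiDiag_transpose : (antiDiag n)ᵀ = antiDiag n := by
  ext i j
  simp only [antiDiag, transpose_apply, of_apply, eq_comm (a := i), Fin.rev_eq_iff]

theorem jordanBlock_transpose_mul_antiDiag :
    (jordanBlock n)ᵀ * antiDiag n = antiDiag n * jordanBlock n := by
  ext i j
  rw [← antiDiag_transpose, ← transpose_mul, transpose_apply, antiDiag_transpose,
    antiDiag_mul_apply, antiDiag_mul_apply]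
  simp only [jordanBlock, of_apply, Fin.val_rev]
  congr 1
  grind

theorem units_coe_mul_self (ε : ℤˣ) : ((ε : ℤ) : ℂ) * ((ε : ℤ) : ℂ) = 1 := by
  exact_mod_cast Int.units_coe_mul_self ε

theorem isEpsForm_stdForm (ε : ℤˣ) (n : ℕ) : IsEpsForm ε (stdForm ε n) := by
  let M : Matrix (Fin n ⊕ Fin n) (Fin n ⊕ Fin n) ℂ :=
    fromBlocks 0 (antiDiag n) (((ε : ℤ) : ℂ) • antiDiag n) 0
  have htranspose : M = ((ε : ℤ) : ℂ) • Mᵀ := by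
    simp [M, fromBlocks_transpose, fromBlocks_smul, antiDiag_transpose, smul_smul,
      units_coe_mul_self]
  have hmul : (((ε : ℤ) : ℂ) • M) * M = 1 := by
    simp [M, fromBlocks_multiply, fromBlocks_smul, antiDiag_mul_self, smul_smul,
      units_coe_mul_self]
  have hM : M.Nondegenerate := nondegenerate_of_det_ne_zero (det_ne_zero_of_left_inverse hmul)
  refine ⟨nondegenerate_toBilin'_iff.2 hM, fun u v => ?_⟩
  calc toBilin' M u v = u ⬝ᵥ (((ε : ℤ) : ℂ) • Mᵀ) *ᵥ v := by rw [← htranspose, toBilin'_apply']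
    _ = ((ε : ℤ) : ℂ) * toBilin' M v u := by
      rw [smul_mulVec, dotProduct_smul, mulVec_transpose, dotProduct_comm, ← dotProduct_mulVec,
        toBilin'_apply', smul_eq_mul]

theorem isSkewAdjoint_stdNilp (ε : ℤˣ) (n : ℕ) : (stdForm ε n).IsSkewAdjoint (stdNilp n) := by
  let A : Matrix (Fin n ⊕ Fin n) (Fin n ⊕ Fin n) ℂ :=
    fromBlocks (jordanBlock n) 0 0 (-jordanBlock n)
  have hneg : -⇑(stdNilp n) = toLin' (-A) := by
    rw [map_neg]
    rfl
  rw [LinearMap.IsSkewAdjoint, hneg]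
  refine (isAdjointPair_toLinearMap₂' _ _ _ _).2 ?_
  simp [A, Matrix.IsAdjointPair, fromBlocks_transpose, fromBlocks_multiply, fromBlocks_neg,
    jordanBlock_transpose_mul_antiDiag]

theorem stdNilp_pow_apply (k : ℕ) (w : Std n) :
    (stdNilp n ^ k) w = Sum.elim (jordanBlock n ^ k *ᵥ (w ∘ Sum.inl))
      ((-jordanBlock n) ^ k *ᵥ (w ∘ Sum.inr)) := by
  rw [stdNilp, ← toLin'_pow, fromBlocks_diagonal_pow, toLin'_apply, fromBlocks_mulVec]
  simp only [zero_mulVec, add_zero, zero_add]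

theorem jordanBlock_mulVec (p : Fin n → ℂ) (j : Fin n) :
    (jordanBlock n *ᵥ p) j = if h : (j : ℕ) + 1 < n then p ⟨j + 1, h⟩ else 0 := by
  simp only [mulVec, dotProduct, jordanBlock, of_apply, ite_mul, one_mul, zero_mul]
  split_ifs with h
  · simpa [Fin.ext_iff] using Fintype.sum_ite_eq (⟨j + 1, h⟩ : Fin n) p
  · exact Finset.sum_eq_zero fun k _ => if_neg (by lia)

theorem jordanBlock_pow_mulVec (k : ℕ) (p : Fin n → ℂ) (j : Fin n) :
    (jordanBlock n ^ k *ᵥ p) j = if h : (j : ℕ) + k < n then p ⟨j + k, h⟩ else 0 := by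
  induction k generalizing j with
  | zero => simp
  | succ k ih =>
    rw [pow_succ', ← mulVec_mulVec, jordanBlock_mulVec]
    simp only [ih]
    grind

theorem jordanBlock_pow_mulVec_eq_zero_iff {k : ℕ} {p : Fin n → ℂ} :
    jordanBlock n ^ k *ᵥ p = 0 ↔ ∀ j : Fin n, k ≤ j → p j = 0 := by
  simp only [funext_iff, jordanBlock_pow_mulVec, Pi.zero_apply, dite_eq_right_iff]
  refine ⟨fun h j hj => ?_, fun h j hj => h _ (Nat.le_add_left k j)⟩
  simpa [Nat.sub_add_cancel hj] using h ⟨j - k, by lia⟩ (by grind)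

theorem mem_ker_stdNilp_pow {k : ℕ} {w : Std n} : w ∈ LinearMap.ker (stdNilp n ^ k) ↔
    ∀ j : Fin n, k ≤ j → w (Sum.inl j) = 0 ∧ w (Sum.inr j) = 0 := by
  have hneg : (-jordanBlock n) ^ k *ᵥ (w ∘ Sum.inr) = 0 ↔
      jordanBlock n ^ k *ᵥ (w ∘ Sum.inr) = 0 := by
    rcases k.even_or_odd with hk | hk
    · rw [hk.neg_pow]
    · rw [hk.neg_pow, neg_mulVec, neg_eq_zero]
  rw [LinearMap.mem_ker, stdNilp_pow_apply, ← Sum.elim_zero_zero, Sum.elim_eq_iff, hneg,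
    jordanBlock_pow_mulVec_eq_zero_iff, jordanBlock_pow_mulVec_eq_zero_iff]
  simp only [Function.comp_apply, imp_and, forall_and]

theorem stdFlag_eq_span_range (i : Fin (n + 1)) :
    stdFlag n i = Submodule.span ℂ (Set.range (Pi.basisFun ℂ (Fin n ⊕ Fin n) ∘
      Sum.map (Fin.castLE i.is_le) (Fin.castLE i.is_le))) := by
  have ha : aVec '' {j : Fin n | (j : ℕ) < i} =
      Set.range (Pi.basisFun ℂ (Fin n ⊕ Fin n) ∘ Sum.inl ∘ Fin.castLE i.is_le) := by
    rw [← Function.comp_assoc, Set.range_comp, Fin.range_castLE]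
    refine Set.image_congr fun j _ => ?_
    simp [aVec]
  have hb : bVec '' {j : Fin n | n ≤ (j : ℕ) + i} =
      Set.range (Pi.basisFun ℂ (Fin n ⊕ Fin n) ∘ Sum.inr ∘ Fin.castLE i.is_le) := by
    have hrev : Fin.rev '' {j : Fin n | n ≤ (j : ℕ) + i} =
        {j : Fin n | (j : ℕ) < i} := by
      rw [Fin.rev_involutive.image_eq_preimage_symm]
      ext j
      simp only [Set.mem_preimage, Set.mem_ofPred_eq, Fin.val_rev]
      lia
    rw [← Function.comp_assoc, Set.range_comp, Fin.range_castLE, ← hrev, Set.image_image]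
    refine Set.image_congr fun j _ => ?_
    simp [bVec]
  rw [stdFlag, ha, hb, ← Set.Sum.elim_range]
  congr 2
  ext (j | j) <;> rfl

theorem mem_stdFlag {i : Fin (n + 1)} {w : Std n} :
    w ∈ stdFlag n i ↔ ∀ j : Fin n, (i : ℕ) ≤ j → w (Sum.inl j) = 0 ∧ w (Sum.inr j) = 0 := by
  have hcastLE (j : Fin n) : (∃ k, Fin.castLE i.is_le k = j) ↔ (j : ℕ) < i :=
    Set.ext_iff.1 (Fin.range_castLE i.is_le) j
  rw [stdFlag_eq_span_range, Set.range_comp, Module.Basis.mem_span_image]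
  simp only [Set.subset_def, Set.mem_range, Sum.forall, Sum.exists, Sum.map_inl, Sum.map_inr,
    Sum.inl.injEq, Sum.inr.injEq, reduceCtorEq, exists_false, or_false, false_or, hcastLE,
    Finset.mem_coe, Finsupp.mem_support_iff, Pi.basisFun_repr, ne_eq, not_imp_comm, forall_and]
  simp only [not_lt]

theorem finrank_stdFlag (i : Fin (n + 1)) : Module.finrank ℂ (stdFlag n i) = 2 * i := by
  have hindep := (Pi.basisFun ℂ (Fin n ⊕ Fin n)).linearIndependent.comp _
    (Sum.map_injective.2 ⟨Fin.castLE_injective i.is_le, Fin.castLE_injective i.is_le⟩)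
  rw [stdFlag_eq_span_range, finrank_span_eq_card hindep, Fintype.card_sum, Fintype.card_fin,
    two_mul]

theorem stdNilp_pow_self : stdNilp n ^ n = 0 :=
  LinearMap.ker_eq_top.1 <| eq_top_iff.2 fun _ _ =>
    mem_ker_stdNilp_pow.2 fun j hj => absurd j.isLt hj.not_gt

theorem isRectangular_std : IsRectangular 2 ((stdNilp n, stdFlag n) : Pt n (Std n)) where
  pow_eq_zero := stdNilp_pow_self
  ker_pow _ := Submodule.ext fun _ => mem_ker_stdNilp_pow.trans mem_stdFlag.symm
  finrank_eq := finrank_stdFlag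

end Std

end Nilcone

open Nilcone in
theorem mainTheorem11_general {V W : Type*} [AddCommGroup V] [Module ℂ V] [FiniteDimensional ℂ V]
    [AddCommGroup W] [Module ℂ W] [FiniteDimensional ℂ W] {n r : ℕ} {ε : ℤˣ}
    {B : LinearMap.BilinForm ℂ V} {C : LinearMap.BilinForm ℂ W} {s : Pt n W}
    (hB : IsEpsForm ε B) (hC : IsEpsForm ε C) (hs : IsRectangular r s)
    (hskew : C.IsSkewAdjoint s.1) :
    IsEpsForm ε (orthSum B C) ∧
    Set.MapsTo (fun x => x.prodMap s.1) (nilcone B n) (nilcone (orthSum B C) n) ∧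
    Set.MapsTo (addSummand s) (cotangentFlags B n) (cotangentFlags (orthSum B C) n) ∧
    (∀ x, addSummand s '' fiber B n x = fiber (orthSum B C) n (x.prodMap s.1)) ∧
    (∀ x, ∀ m' ∈ cotangentFlags (orthSum B C) n, proj m' = x.prodMap s.1 →
      ∃! m : Pt n V, m ∈ cotangentFlags B n ∧ addSummand s m = m' ∧ proj m = x) ∧
    IsVarietyIso (addSummand s) (cotangentFlags B n)
      {m' | m' ∈ cotangentFlags (orthSum B C) n ∧
        proj m' ∈ (fun x => x.prodMap s.1) '' nilcone B n} ∧
    (∀ x,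
      (∀ k : ℕ, Module.finrank ℂ (LinearMap.ker (x.prodMap s.1 ^ k)) =
        Module.finrank ℂ (LinearMap.ker (x ^ k)) + r * min k n) ∧
      IsVarietyIso (addSummand s) (fiber B n x) (fiber (orthSum B C) n (x.prodMap s.1)) ∧
      ∀ d : Fin n → ℕ,
        IsVarietyIso (addSummand s) (spaltenstein B d x)
          (spaltenstein (orthSum B C) (fun i => d i + r) (x.prodMap s.1)) ∧
        ∀ {V' : Type*} [AddCommGroup V'] [Module ℂ V'] (B' : LinearMap.BilinForm ℂ V')
          (x' : Module.End ℂ V') (g : (V × W) ≃ₗ[ℂ] V'),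
          (∀ u w, B' (g u) (g w) = orthSum B C u w) → x' = g.conj (x.prodMap s.1) →
          ∃ φ : Pt n V → Pt n V', IsVarietyIso φ (spaltenstein B d x)
            (spaltenstein B' (fun i => d i + r) x')) := by
  have hmem : s ∈ cotangentFlags C n := hs.mem_cotangentFlags hC.1.2 hskew
  have hspal (x : Module.End ℂ V) (d : Fin n → ℕ) : IsVarietyIso (addSummand s)
      (spaltenstein B d x) (spaltenstein (orthSum B C) (fun i => d i + r) (x.prodMap s.1)) :=
    isVarietyIso_addSummand s (hs.image_addSummand_spaltenstein hmem d x)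
  refine ⟨isEpsForm_orthSum hB hC, fun _ hx => prodMap_mem_nilcone_iff.2 ⟨hx, hmem.1⟩,
    fun _ hm => addSummand_mem_cotangentFlags_iff.2 ⟨hm, hmem⟩, hs.image_addSummand_fiber hmem,
    fun x m' hm' hx => ?_, isVarietyIso_addSummand s (hs.image_addSummand_cotangentFlags hmem),
    fun x => ⟨hs.finrank_ker_prodMap_pow x,
      isVarietyIso_addSummand s (hs.image_addSummand_fiber hmem x), fun d => ⟨hspal x d, ?_⟩⟩⟩
  · obtain ⟨m, ⟨hm, hmx⟩, rfl⟩ := hs.mem_image_addSummand_fiber ⟨hm', hx⟩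
    exact ⟨m, ⟨hm, rfl, hmx⟩, fun _ h => addSummand_injective s h.2.1⟩
  · rintro V' _ _ B' _ g hg rfl
    exact ⟨transport g ∘ addSummand s,
      (isVarietyIso_transport_spaltenstein hg _ _).comp (hspal x d)⟩

theorem mainTheorem11 {V : Type*} [AddCommGroup V] [Module ℂ V] [FiniteDimensional ℂ V]
    (n : ℕ) (hn : 2 ≤ n) (ε : ℤˣ) (B : LinearMap.BilinForm ℂ V) (hB : Nilcone.IsEpsForm ε B) :
    -- the square is a well defined commutative square
    Nilcone.IsEpsForm ε (Nilcone.sumForm B ε n) ∧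
    Set.MapsTo (Nilcone.iNil n) (Nilcone.nilcone B n)
      (Nilcone.nilcone (Nilcone.sumForm B ε n) n) ∧
    Set.MapsTo Nilcone.iM (Nilcone.cotangentFlags B n)
      (Nilcone.cotangentFlags (Nilcone.sumForm B ε n) n) ∧
    (∀ m ∈ Nilcone.cotangentFlags B n,
      Nilcone.proj (Nilcone.iM m) = Nilcone.iNil n (Nilcone.proj m)) ∧
    -- it is cartesian
    (∀ x ∈ Nilcone.nilcone B n,
      Nilcone.iM '' Nilcone.fiber B n x =
        Nilcone.fiber (Nilcone.sumForm B ε n) n (Nilcone.iNil n x)) ∧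
    (∀ x ∈ Nilcone.nilcone B n, ∀ m' ∈ Nilcone.cotangentFlags (Nilcone.sumForm B ε n) n,
      Nilcone.proj m' = Nilcone.iNil n x →
        ∃! m : Nilcone.Pt n V,
          m ∈ Nilcone.cotangentFlags B n ∧ Nilcone.iM m = m' ∧ Nilcone.proj m = x) ∧
    Nilcone.IsVarietyIso Nilcone.iM (Nilcone.cotangentFlags B n)
      {m' | m' ∈ Nilcone.cotangentFlags (Nilcone.sumForm B ε n) n ∧
        Nilcone.proj m' ∈ Nilcone.iNil n '' Nilcone.nilcone B n} ∧
    -- fibres and Spaltenstein varieties do not change under row reduction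
    (∀ x ∈ Nilcone.nilcone B n,
      (∀ k : ℕ, Module.finrank ℂ (LinearMap.ker (Nilcone.iNil n x ^ k)) =
        Module.finrank ℂ (LinearMap.ker (x ^ k)) + 2 * min k n) ∧
      Nilcone.IsVarietyIso Nilcone.iM (Nilcone.fiber B n x)
        (Nilcone.fiber (Nilcone.sumForm B ε n) n (Nilcone.iNil n x)) ∧
      ∀ d : Fin n → ℕ,
        Nilcone.IsVarietyIso Nilcone.iM (Nilcone.spaltenstein B d x)
          (Nilcone.spaltenstein (Nilcone.sumForm B ε n) (fun i => d i + 2) (Nilcone.iNil n x)) ∧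
        ∀ {V' : Type*} [AddCommGroup V'] [Module ℂ V'] (B' : LinearMap.BilinForm ℂ V')
          (x' : Module.End ℂ V') (g : (V × Nilcone.Std n) ≃ₗ[ℂ] V'),
          (∀ u w, B' (g u) (g w) = Nilcone.sumForm B ε n u w) →
          x' = g.conj (Nilcone.iNil n x) →
          ∃ φ : Nilcone.Pt n V → Nilcone.Pt n V',
            Nilcone.IsVarietyIso φ (Nilcone.spaltenstein B d x)
              (Nilcone.spaltenstein B' (fun i => d i + 2) x')) := by
  obtain ⟨hform, hnil, hcot, hfiber, hunique, hiso, hred⟩ := mainTheorem11_general hB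
    (Nilcone.isEpsForm_stdForm ε n) Nilcone.isRectangular_std (Nilcone.isSkewAdjoint_stdNilp ε n)
  exact ⟨hform, hnil, hcot, fun _ _ => rfl, fun x _ => hfiber x, fun x _ => hunique x, hiso,
    fun x _ => hred x⟩
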